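/- Let $L\in\mathbb{N}$, let $\Lambda=\{-L+1,\dots,L\}$, and let $r,\ell\in(0,\infty)$. A configuration is a map $\eta:\Lambda\to\{0,1,2\}$, where $\eta(k)=0,1,2$ means that site $k$ carries a particle of type $A$, is vacant, or carries a particle of type $B$, respectively. Write $a_k(\eta)=\delta_{\eta(k),0}$, $v_k(\eta)=\delta_{\eta(k),1}$, $b_k(\eta)=\delta_{\eta(k),2}$, $N(\eta)=\sum_{k} a_k(\eta)$, $M(\eta)=\sum_{k} b_k(\eta)$, and let $\eta^{k,k+1}$ be $\eta$ with the contents of sites $k$ and $k+1$ interchanged. The two-component ASEP (with reflecting boundaries) is the continuous-time Markov chain on configurations with generator $$\mathcal{L}f(\eta)=\sum_{k=-L+1}^{L-1}w^{k,k+1}(\eta)\,\bigl[f(\eta^{k,k+1})-f(\eta)\bigr],$$ $$w^{k,k+1}=r\,(a_kv_{k+1}+v_kb_{k+1}+a_kb_{k+1})+\ell\,(v_ka_{k+1}+b_kv_{k+1}+b_ka_{k+1}).$$ Its generator matrix $H$ is defined by $\mathcal{L}f(\eta)=-\sum_{\eta'}f(\eta')H_{\eta'\eta}$; thus $H_{\eta'\eta}$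 is minus the rate of the transition $\eta\to\eta'$ for $\eta\neq\eta'$, the columns of $H$ sum to $0$, and the transition probabilities are $P(\eta',t|\eta,0)=(\mathrm{e}^{-Ht})_{\eta'\eta}$. Put $q=\sqrt{r/\ell}$ and let $$\pi(\eta)=q^{\sum_{k=-L+1}^{L}(2k-1)(a_k-b_k)+\sum_{k=-L+1}^{L-1}\sum_{l=-L+1}^{k}(a_lb_{k+1}-b_la_{k+1})}$$ be the (unnormalized) reversible measure. For $x,y\in\Lambda$ let $$Q^A_x(\eta)=q^{\sum_{k<x}a_k-\sum_{k>x}a_k}\,a_x,\qquad Q^B_y(\eta)=q^{-\sum_{k<y}b_k+\sum_{k>y}b_k}\,b_y,$$ and for a configuration $\mathbf z$ let $$Q_{\mathbf z}(\eta)=\prod_{x:\,\mathbf z(x)=0}Q^A_x(\eta)\prod_{y:\,\mathbf z(y)=2}Q^B_y(\eta),\qquad D(\mathbf z,\eta)=\pi(\mathbf z)^{-1}Q_{\mathbf z}(\eta).$$ **Theorem.** The two-component ASEP is self-dual with respect to $D$: for all $t\ge 0$ and all configurations $\mathbf z,\eta$, $$\sum_{\eta'}D(\mathbf z,\eta')\,P(\eta',t|\eta,0)=\sum_{\mathbf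 z'}D(\mathbf z',\eta)\,P(\mathbf z',t|\mathbf z,0).$$ In matrix form, $DH=H^{T}D$. Moreover, for all $N',M',N,M\ge 0$ the process is self-dual, in the same sense, with respect to the function that equals $D(\mathbf z,\eta)$ if $N(\mathbf z)=N'$, $M(\mathbf z)=M'$, $N(\eta)=N$, $M(\eta)=M$, and equals $0$ otherwise. -/

import Mathlib

namespace TwoASEP

/-- The lattice `Λ = {-L+1, …, L}`. -/
abbrev Site (L : ℕ) : Type := {k : ℤ // k ∈ Finset.Icc (-(L : ℤ) + 1) L}

/-- The bonds `(k, k+1)` of `Λ`, indexed by their left end `k ∈ {-L+1, …, L-1}`. -/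
abbrev Bond (L : ℕ) : Type := {k : ℤ // k ∈ Finset.Icc (-(L : ℤ) + 1) ((L : ℤ) - 1)}

/-- The left end `k` of the bond `(k, k+1)`. -/
def Bond.left {L : ℕ} (k : Bond L) : Site L :=
  ⟨k.1, by have h := Finset.mem_Icc.mp k.2; exact Finset.mem_Icc.mpr ⟨h.1, by omega⟩⟩

/-- The right end `k + 1` of the bond `(k, k+1)`. -/
def Bond.right {L : ℕ} (k : Bond L) : Site L :=
  ⟨k.1 + 1, by have h := Finset.mem_Icc.mp k.2; exact Finset.mem_Icc.mpr ⟨by omega, by omega⟩⟩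

/-- Configurations: `0` is a particle of type `A`, `1` a vacancy, `2` a particle of type `B`. -/
abbrev Config (L : ℕ) : Type := Site L → Fin 3

variable {L : ℕ}

/-- `a_k(η)`, equal to `1` if site `k` carries an `A`-particle and to `0` otherwise. -/
def a (η : Config L) (k : Site L) : ℤ := if η k = 0 then 1 else 0

/-- `v_k(η)`, equal to `1` if site `k` is vacant and to `0` otherwise. -/
def v (η : Config L) (k : Site L) : ℤ := if η k = 1 then 1 else 0

/-- `b_k(η)`, equal to `1` if site `k` carries a `B`-particle and to `0` otherwise. -/
def b (η : Config L) (k : Site L) : ℤ := if η k = 2 then 1 else 0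

/-- The set of positions of the `A`-particles. -/
noncomputable def posA (z : Config L) : Finset (Site L) := Finset.univ.filter fun k => z k = 0

/-- The set of positions of the `B`-particles. -/
noncomputable def posB (z : Config L) : Finset (Site L) := Finset.univ.filter fun k => z k = 2

/-- The number of `A`-particles. -/
noncomputable def numA (η : Config L) : ℕ := (posA η).card

/-- The number of `B`-particles. -/
noncomputable def numB (η : Config L) : ℕ := (posB η).card

/-- The configuration `η^{k,k+1}`, in which the contents of `k` and `k + 1` are interchanged. -/
def exchange (k : Bond L) (η : Config L) : Config L := fun j => η (Equiv.swap k.left k.right j)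

/-- The local hopping rate `w^{k,k+1}(η)`. -/
noncomputable def localRate (r l : ℝ) (k : Bond L) (η : Config L) : ℝ :=
  r * ((a η k.left * v η k.right + v η k.left * b η k.right + a η k.left * b η k.right : ℤ) : ℝ)
  + l * ((v η k.left * a η k.right + b η k.left * v η k.right + b η k.left * a η k.right : ℤ) : ℝ)

/-- The generator of the two-component ASEP, acting on functions of the configuration. -/
noncomputable def generator (r l : ℝ) (f : Config L → ℝ) (η : Config L) : ℝ :=
  ∑ k : Bond L, localRate r l k η * (f (exchange k η) - f η)

/-- The transition rate `w(η → η')`. -/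
noncomputable def rate (r l : ℝ) (η η' : Config L) : ℝ :=
  ∑ k : Bond L, localRate r l k η * (if η' = exchange k η then 1 else 0)

/-- The generator matrix `H`: the entry in row `η'` and column `η` is `-w(η → η')` off the
diagonal, and the total rate of leaving `η` on the diagonal. -/
noncomputable def H (L : ℕ) (r l : ℝ) : Matrix (Config L) (Config L) ℝ := Matrix.of fun η' η =>
  if η = η' then ∑ ζ ∈ Finset.univ.filter (fun ζ => ζ ≠ η), rate r l η ζ else -rate r l η η'

/-- `H` is the matrix of the generator: `(ℒ f)(η) = - ∑_{η'} f(η') H_{η' η}`. -/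
theorem generator_eq (r l : ℝ) (f : Config L → ℝ) (η : Config L) :
    generator r l f η = -∑ η' : Config L, f η' * H L r l η' η := by
  have h1 : generator r l f η = ∑ ζ : Config L, rate r l η ζ * (f ζ - f η) := by
    unfold generator rate
    simp_rw [Finset.sum_mul]
    rw [Finset.sum_comm]
    refine Finset.sum_congr rfl fun k _ => ?_
    rw [Finset.sum_eq_single (exchange k η)]
    · simp
    · intro ζ _ h; simp [h]
    · simp
  have h2 : ∀ g : Config L → ℝ, ∑ ζ, g ζ = g η + ∑ ζ ∈ Finset.univ.filter (fun ζ => ζ ≠ η), g ζ := by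
    intro g
    rw [Finset.filter_ne', Finset.add_sum_erase _ _ (Finset.mem_univ η)]
  rw [h1, h2, h2 (fun η' => f η' * H L r l η' η)]
  have h3 : ∑ ζ ∈ Finset.univ.filter (fun ζ => ζ ≠ η), f ζ * H L r l ζ η
      = ∑ ζ ∈ Finset.univ.filter (fun ζ => ζ ≠ η), -(f ζ * rate r l η ζ) := by
    refine Finset.sum_congr rfl fun ζ hζ => ?_
    have : η ≠ ζ := fun h => (Finset.mem_filter.mp hζ).2 h.symm
    simp [H, this]
  rw [h3]
  simp only [H, Matrix.of_apply, if_true, sub_self, mul_zero, zero_add, Finset.mul_sum,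
    ← Finset.sum_add_distrib, ← Finset.sum_neg_distrib]
  exact Finset.sum_congr rfl fun ζ _ => by ring

/-- The asymmetry parameter `q`. -/
noncomputable def q (r l : ℝ) : ℝ := Real.sqrt (r / l)

/-- The (unnormalized) reversible measure `π`. -/
noncomputable def reversibleMeasure (r l : ℝ) (η : Config L) : ℝ :=
  q r l ^ (∑ k : Site L, (2 * k.1 - 1) * (a η k - b η k)
    + ∑ k : Bond L, ∑ j ∈ Finset.univ.filter (fun j : Site L => j ≤ k.left),
        (a η j * b η k.right - b η j * a η k.right))

/-- `Q^A_x(η)`. -/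
noncomputable def QA (r l : ℝ) (x : Site L) (η : Config L) : ℝ :=
  q r l ^ (∑ k ∈ Finset.univ.filter (fun k : Site L => k < x), a η k
    - ∑ k ∈ Finset.univ.filter (fun k : Site L => x < k), a η k) * (a η x : ℝ)

/-- `Q^B_y(η)`. -/
noncomputable def QB (r l : ℝ) (y : Site L) (η : Config L) : ℝ :=
  q r l ^ (-∑ k ∈ Finset.univ.filter (fun k : Site L => k < y), b η k
    + ∑ k ∈ Finset.univ.filter (fun k : Site L => y < k), b η k) * (b η y : ℝ)

/-- `Q_z(η)`, the product over the particle positions of `z`. -/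
noncomputable def Q (r l : ℝ) (z η : Config L) : ℝ :=
  (∏ x ∈ posA z, QA r l x η) * ∏ y ∈ posB z, QB r l y η

/-- The duality function `D(z, η) = π(z)⁻¹ Q_z(η)`. -/
noncomputable def D (L : ℕ) (r l : ℝ) (z η : Config L) : ℝ :=
  (reversibleMeasure r l z)⁻¹ * Q r l z η

/-- The restriction of the duality function to `z` with `N'` particles of type `A` and `M'` of
type `B`, and `η` with `N` particles of type `A` and `M` of type `B`. -/
noncomputable def Dsector (L : ℕ) (r l : ℝ) (N' M' N M : ℕ) (z η : Config L) : ℝ :=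
  if (numA z = N' ∧ numB z = M') ∧ (numA η = N ∧ numB η = M) then D L r l z η else 0

section Duality

variable {X Ω : Type*} [Fintype X] [DecidableEq X] [Fintype Ω] [DecidableEq Ω]

/-- The probability `P(ω', t | ω, 0)` that the Markov process with generator matrix `H`
(convention: `H_{ω' ω} = -w(ω → ω')` off the diagonal, and zero column sums) is in `ω'` at time
`t`, when started in `ω`. -/
noncomputable def transProb (H : Matrix Ω Ω ℝ) (t : ℝ) (ω' ω : Ω) : ℝ :=
  (NormedSpace.exp (-(t • H))) ω' ω

/-- The expectation of `f` at time `t` for the process started in `ω`. -/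
noncomputable def expectation (H : Matrix Ω Ω ℝ) (t : ℝ) (f : Ω → ℝ) (ω : Ω) : ℝ :=
  ∑ ω' : Ω, f ω' * transProb H t ω' ω

/-- Duality of the processes `ω_t`, `x_t` with generator matrices `H`, `G`, with respect to `D`:
`⟨D(x, ω_t)⟩_ω = ⟨D(x_t, ω)⟩_x`. -/
def IsDual (H : Matrix Ω Ω ℝ) (G : Matrix X X ℝ) (D : X → Ω → ℝ) : Prop :=
  ∀ t : ℝ, 0 ≤ t → ∀ (x : X) (ω : Ω),
    expectation H t (fun ω' => D x ω') ω = expectation G t (fun x' => D x' ω) x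

end Duality

end TwoASEP

/-!
Both generators are sums over the bonds, and the duality relation already holds bond by bond: with
`w` the rate of the bond `k` and `z^k` the exchanged configuration,
`w(η) (D(z, η^k) - D(z, η)) = w(z) (D(z^k, η) - D(z, η))` (`localRate_mul_sub_eq`). Summing over
`k` gives `D H = Hᵀ D` (`mul_H_eq_transpose_H_mul`), and this relation passes to the matrix
exponentials, which is duality (`isDual_of_mul_eq_transpose_mul`). Since an exchange preserves the
particle numbers, the restriction of `D` to a sector satisfies the same relation on each bond.

For the relation on a bond, `D(z, η)` is written as a power of `q` times a product over the sites
of indicators that a particle of `z` is also present in `η` (`D_eq`). The exponent is built from a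
one-body sum and from the antisymmetric form `ordSum f g = ∑_{x,y} sgn(x - y) f(x) g(y)`. Exchanging
two adjacent sites changes the sign of `x - y` only when `x, y` are these two sites, so the
exponent changes by a quantity depending on the contents of the bond alone, and the indicators
away from the bond do not change. With `q² = r / l`, what is left is a finite check over the
contents of the bond in `z` and in `η`.
-/

namespace TwoASEP

variable {L : ℕ}

/-! ### Intertwining and duality -/

/-- An intertwining relation between `H` and its transpose passes to their exponentials, hence
makes the process self-dual. -/
theorem isDual_of_mul_eq_transpose_mul {X : Type*} [Fintype X] [DecidableEq X]
    (H : Matrix X X ℝ) (F : X → X → ℝ)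
    (h : Matrix.of F * H = H.transpose * Matrix.of F) : IsDual H H F := by
  intro t _ x ω
  have hs : SemiconjBy (Matrix.of F) (-(t • H)) (-(t • H)).transpose := by
    simp [SemiconjBy, h]
  have he : SemiconjBy (Matrix.of F) (NormedSpace.exp (-(t • H)))
      (NormedSpace.exp (-(t • H)).transpose) := by
    open scoped Matrix.Norms.Operator in exact hs.exp_right
  rw [Matrix.exp_transpose] at he
  have hxω := congrFun (congrFun he.eq x) ω
  simpa [Matrix.mul_apply, expectation, transProb, mul_comm] using hxω

/-- Both sides of `F H = Hᵀ F` are the generator, acting on the second and on the first argument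
of `F`; it is enough to compare them bond by bond. -/
theorem mul_H_eq_transpose_H_mul (r l : ℝ) (F : Config L → Config L → ℝ)
    (h : ∀ (k : Bond L) (z η : Config L),
      localRate r l k η * (F z (exchange k η) - F z η) =
        localRate r l k z * (F (exchange k z) η - F z η)) :
    Matrix.of F * H L r l = (H L r l).transpose * Matrix.of F := by
  ext z η
  have h1 := generator_eq r l (F z) η
  have h2 := generator_eq r l (fun z' => F z' η) z
  have h3 : generator r l (F z) η = generator r l (fun z' => F z' η) z :=
    Finset.sum_congr rfl fun k _ => h k z η
  simp only [Matrix.mul_apply, Matrix.of_apply, Matrix.transpose_apply]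
  simp_rw [mul_comm (H L r l _ z)]
  linarith

/-! ### Effect of an exchange on sums over the lattice -/

theorem Bond.left_ne_right (k : Bond L) : k.left ≠ k.right := by
  intro h
  have := congrArg Subtype.val h
  simp [Bond.left, Bond.right] at this

/-- Only the two end points of the bond contribute to the change of a sum under an exchange. -/
theorem sum_mul_swap (k : Bond L) (c g : Site L → ℤ) :
    ∑ y, c y * g (Equiv.swap k.left k.right y) =
      ∑ y, c y * g y + (c k.left - c k.right) * (g k.right - g k.left) := by
  have hne := k.left_ne_right
  have h : ∀ y, c y * g (Equiv.swap k.left k.right y) = c y * g y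
      + ((if y = k.left then c y * (g k.right - g k.left) else 0)
        - if y = k.right then c y * (g k.right - g k.left) else 0) := by
    intro y
    by_cases h1 : y = k.left
    · subst h1; simp [hne]; ring
    by_cases h2 : y = k.right
    · subst h2; simp [hne.symm]; ring
    simp [h1, h2, Equiv.swap_apply_of_ne_of_ne]
  simp_rw [h, Finset.sum_add_distrib, Finset.sum_sub_distrib]
  simp
  ring

/-- The bilinear form `∑_{x,y} sgn(x - y) f(x) g(y)`: every exponent of `q` that depends on the
order of the particles is a combination of its values. -/
noncomputable def ordSum (f g : Site L → ℤ) : ℤ := ∑ x, ∑ y, (x.1 - y.1).sign * f x * g y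

/-- The order of `x` relative to the two ends of a bond is the same unless `x` is one of them. -/
theorem sign_sub_left_sub_sign_sub_right (k : Bond L) (x : Site L) :
    (x.1 - k.left.1).sign - (x.1 - k.right.1).sign
      = (if x = k.left then 1 else 0) + (if x = k.right then 1 else 0) := by
  have e1 : x = k.left ↔ x.1 = k.1 := Subtype.ext_iff
  have e2 : x = k.right ↔ x.1 = k.1 + 1 := Subtype.ext_iff
  simp only [e1, e2]
  change (x.1 - k.1).sign - (x.1 - (k.1 + 1)).sign = _
  rcases lt_trichotomy x.1 k.1 with h | h | h
  · rw [Int.sign_eq_neg_one_of_neg (by omega), Int.sign_eq_neg_one_of_neg (by omega),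
      if_neg (by omega), if_neg (by omega)]; rfl
  · rw [h, if_pos rfl, if_neg (by omega)]; simp
  · rcases eq_or_lt_of_le (Int.add_one_le_iff.mpr h) with h' | h'
    · rw [← h', if_neg (by omega), if_pos rfl]; simp
    · rw [Int.sign_eq_one_of_pos (by omega), Int.sign_eq_one_of_pos (by omega),
        if_neg (by omega), if_neg (by omega)]; rfl

theorem ordSum_antisymm (f g : Site L → ℤ) : ordSum f g = -ordSum g f := by
  unfold ordSum
  rw [Finset.sum_comm, ← Finset.sum_neg_distrib]
  refine Finset.sum_congr rfl fun y _ => ?_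
  rw [← Finset.sum_neg_distrib]
  refine Finset.sum_congr rfl fun x _ => ?_
  rw [← neg_sub x.1 y.1, Int.sign_neg]
  ring

theorem ordSum_swap_right (k : Bond L) (f g : Site L → ℤ) :
    ordSum f (fun y => g (Equiv.swap k.left k.right y)) =
      ordSum f g + (f k.left + f k.right) * (g k.right - g k.left) := by
  unfold ordSum
  simp_rw [sum_mul_swap, Finset.sum_add_distrib]
  congr 1
  rw [← Finset.sum_mul]
  congr 1
  simp_rw [← sub_mul, sign_sub_left_sub_sign_sub_right, add_mul, Finset.sum_add_distrib]
  simp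

theorem ordSum_swap_left (k : Bond L) (f g : Site L → ℤ) :
    ordSum (fun y => f (Equiv.swap k.left k.right y)) g =
      ordSum f g - (g k.left + g k.right) * (f k.right - f k.left) := by
  rw [ordSum_antisymm, ordSum_swap_right, ordSum_antisymm f]
  ring

/-! ### The duality function as a power of `q` times an indicator -/

theorem sum_lt_sub_sum_gt (f : Site L → ℤ) (x : Site L) :
    ∑ k ∈ Finset.univ.filter (fun k : Site L => k < x), f k
      - ∑ k ∈ Finset.univ.filter (fun k : Site L => x < k), f k
      = ∑ k, (x.1 - k.1).sign * f k := by
  rw [Finset.sum_filter, Finset.sum_filter, ← Finset.sum_sub_distrib]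
  refine Finset.sum_congr rfl fun k _ => ?_
  simp only [← Subtype.coe_lt_coe]
  rcases lt_trichotomy k.1 x.1 with h | h | h
  · rw [Int.sign_eq_one_of_pos (by omega), if_pos h, if_neg (by omega)]; ring
  · simp [h]
  · rw [Int.sign_eq_neg_one_of_neg (by omega), if_neg (by omega), if_pos h]; ring

/-- The sum over bonds misses only the leftmost site, which has nothing to its left. -/
theorem sum_bond_right (f : Site L → Site L → ℤ) :
    ∑ k : Bond L, ∑ j ∈ Finset.univ.filter (fun j : Site L => j ≤ k.left), f j k.right
      = ∑ y : Site L, ∑ j ∈ Finset.univ.filter (fun j : Site L => j < y), f j y := by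
  refine Finset.sum_of_injOn Bond.right ?_ (by simp) ?_ ?_
  · intro k _ k' _ h
    have := congrArg Subtype.val h
    simp only [Bond.right] at this
    exact Subtype.ext (by omega)
  · intro y _ hy
    refine Finset.sum_eq_zero fun j hj => ?_
    have hj' : j.1 < y.1 := (Finset.mem_filter.mp hj).2
    refine absurd ⟨⟨y.1 - 1, ?_⟩, by simp, Subtype.ext ?_⟩ hy
    · have h1 := Finset.mem_Icc.mp j.2
      have h2 := Finset.mem_Icc.mp y.2
      exact Finset.mem_Icc.mpr ⟨by omega, by omega⟩
    · simp [Bond.right]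
  · intro k _
    refine Finset.sum_congr (Finset.filter_congr fun j _ => ?_) fun _ _ => rfl
    rw [← Subtype.coe_le_coe, ← Subtype.coe_lt_coe]
    exact Int.lt_add_one_iff.symm

/-- The exponent of `q` in the reversible measure. -/
noncomputable def measureExponent (η : Config L) : ℤ :=
  ∑ k : Site L, (2 * k.1 - 1) * (a η k - b η k) + ordSum (b η) (a η)

theorem reversibleMeasure_eq (r l : ℝ) (η : Config L) :
    reversibleMeasure r l η = q r l ^ measureExponent η := by
  unfold reversibleMeasure measureExponent
  congr 2
  rw [sum_bond_right (fun j y => a η j * b η y - b η j * a η y)]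
  simp_rw [Finset.sum_sub_distrib]
  -- Renaming the sites turns the second sum into one over the sites to the right of `y`.
  have h : ∑ y : Site L, ∑ j ∈ Finset.univ.filter (fun j : Site L => j < y), b η j * a η y
      = ∑ y : Site L, ∑ j ∈ Finset.univ.filter (fun j : Site L => y < j), a η j * b η y := by
    simp_rw [Finset.sum_filter]
    rw [Finset.sum_comm]
    simp_rw [mul_comm]
  rw [h, ← Finset.sum_sub_distrib]
  refine Finset.sum_congr rfl fun y _ => ?_
  rw [sum_lt_sub_sum_gt (fun j => a η j * b η y)]
  exact Finset.sum_congr rfl fun j _ => by ring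

/-- The exponent of `q` in `Q z η`, when `η` extends `z`. -/
noncomputable def productExponent (z η : Config L) : ℤ := ordSum (a z) (a η) - ordSum (b z) (b η)

/-- The indicator that the content `j` of a site of `η` is allowed above the content `i` of the
same site of `z`: a vacancy of `z` imposes nothing, a particle of `z` must be present in `η`. -/
def siteMatch (i j : Fin 3) : ℝ := if i = 1 ∨ i = j then 1 else 0

theorem prod_zpow_mul {ι : Type*} (s : Finset ι) {c : ℝ} (hc : c ≠ 0) (e : ι → ℤ) (f : ι → ℝ) :
    ∏ x ∈ s, c ^ e x * f x = c ^ (∑ x ∈ s, e x) * ∏ x ∈ s, f x := by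
  classical
  induction s using Finset.induction_on with
  | empty => simp
  | insert x s hx ih =>
    rw [Finset.prod_insert hx, Finset.prod_insert hx, Finset.sum_insert hx, ih, zpow_add₀ hc]
    ring

theorem q_pos {r l : ℝ} (hr : 0 < r) (hl : 0 < l) : 0 < q r l :=
  Real.sqrt_pos.mpr (div_pos hr hl)

theorem Q_eq {r l : ℝ} (hr : 0 < r) (hl : 0 < l) (z η : Config L) :
    Q r l z η = q r l ^ productExponent z η * ∏ x, siteMatch (z x) (η x) := by
  have hq := (q_pos hr hl).ne'
  have hA : ∀ x, ∑ k ∈ Finset.univ.filter (fun k : Site L => k < x), a η k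
      - ∑ k ∈ Finset.univ.filter (fun k : Site L => x < k), a η k
      = ∑ k, (x.1 - k.1).sign * a η k := sum_lt_sub_sum_gt (a η)
  have hB : ∀ x, -∑ k ∈ Finset.univ.filter (fun k : Site L => k < x), b η k
      + ∑ k ∈ Finset.univ.filter (fun k : Site L => x < k), b η k
      = -∑ k, (x.1 - k.1).sign * b η k := fun x => by
    rw [← sum_lt_sub_sum_gt (b η)]; ring
  unfold Q QA QB
  simp_rw [hA, hB]
  rw [prod_zpow_mul _ hq, prod_zpow_mul _ hq, mul_mul_mul_comm, ← zpow_add₀ hq]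
  congr 2
  · unfold productExponent ordSum posA posB
    rw [Finset.sum_filter, Finset.sum_filter, ← Finset.sum_add_distrib, ← Finset.sum_sub_distrib]
    refine Finset.sum_congr rfl fun x _ => ?_
    simp_rw [mul_right_comm _ (a z x), mul_right_comm _ (b z x), ← Finset.sum_mul, a, b]
    split_ifs <;> ring
  · unfold posA posB
    rw [Finset.prod_filter, Finset.prod_filter, ← Finset.prod_mul_distrib]
    refine Finset.prod_congr rfl fun x _ => ?_
    simp only [a, b, siteMatch]
    generalize z x = i
    generalize η x = j
    fin_cases i <;> fin_cases j <;> simp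

theorem D_eq {r l : ℝ} (hr : 0 < r) (hl : 0 < l) (z η : Config L) :
    D L r l z η = q r l ^ (productExponent z η - measureExponent z)
      * ∏ x, siteMatch (z x) (η x) := by
  rw [D, Q_eq hr hl, reversibleMeasure_eq, zpow_sub₀ (q_pos hr hl).ne']
  ring

/-! ### The identity on a single bond -/

theorem prod_siteMatch (k : Bond L) (z η : Config L) :
    ∏ x, siteMatch (z x) (η x) =
      siteMatch (z k.left) (η k.left) * siteMatch (z k.right) (η k.right)
        * ∏ x ∈ ({k.left, k.right} : Finset (Site L))ᶜ, siteMatch (z x) (η x) := by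
  rw [← Finset.prod_pair (f := fun x => siteMatch (z x) (η x)) k.left_ne_right,
    Finset.prod_mul_prod_compl]

theorem exchange_left (k : Bond L) (η : Config L) : exchange k η k.left = η k.right := by
  simp [exchange]

theorem exchange_right (k : Bond L) (η : Config L) : exchange k η k.right = η k.left := by
  simp [exchange]

theorem exchange_of_mem_compl (k : Bond L) (η : Config L) {x : Site L}
    (hx : x ∈ ({k.left, k.right} : Finset (Site L))ᶜ) : exchange k η x = η x := by
  simp only [Finset.mem_compl, Finset.mem_insert, Finset.mem_singleton, not_or] at hx
  simp [exchange, Equiv.swap_apply_of_ne_of_ne hx.1 hx.2]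

theorem productExponent_exchange_right (k : Bond L) (z η : Config L) :
    productExponent z (exchange k η) = productExponent z η
      + ((a z k.left + a z k.right) * (a η k.right - a η k.left)
        - (b z k.left + b z k.right) * (b η k.right - b η k.left)) := by
  have h1 := ordSum_swap_right k (a z) (a η)
  have h2 := ordSum_swap_right k (b z) (b η)
  unfold productExponent
  change ordSum (a z) (fun y => a η (Equiv.swap k.left k.right y))
    - ordSum (b z) (fun y => b η (Equiv.swap k.left k.right y)) = _
  rw [h1, h2]
  ring

theorem productExponent_exchange_left (k : Bond L) (z η : Config L) :
    productExponent (exchange k z) η = productExponent z η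
      - ((a η k.left + a η k.right) * (a z k.right - a z k.left)
        - (b η k.left + b η k.right) * (b z k.right - b z k.left)) := by
  have h1 := ordSum_swap_left k (a z) (a η)
  have h2 := ordSum_swap_left k (b z) (b η)
  unfold productExponent
  change ordSum (fun y => a z (Equiv.swap k.left k.right y)) (a η)
    - ordSum (fun y => b z (Equiv.swap k.left k.right y)) (b η) = _
  rw [h1, h2]
  ring

theorem measureExponent_exchange (k : Bond L) (η : Config L) :
    measureExponent (exchange k η) = measureExponent η
      - 2 * ((a η k.right - b η k.right) - (a η k.left - b η k.left)
        + (a η k.left * b η k.right - b η k.left * a η k.right)) := by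
  have h1 := sum_mul_swap k (fun x => 2 * x.1 - 1) (fun x => a η x - b η x)
  -- The form is exchanged in one argument at a time.
  have h2 := ordSum_swap_left k (b η) (fun y => a η (Equiv.swap k.left k.right y))
  have h3 := ordSum_swap_right k (b η) (a η)
  unfold measureExponent
  change ∑ x : Site L, (2 * x.1 - 1) * (a η (Equiv.swap k.left k.right x)
      - b η (Equiv.swap k.left k.right x))
    + ordSum (fun y => b η (Equiv.swap k.left k.right y))
      (fun y => a η (Equiv.swap k.left k.right y)) = _
  rw [h1, h2, h3]
  simp only [Equiv.swap_apply_left, Equiv.swap_apply_right, Bond.left, Bond.right]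
  ring

/-- The contribution of each bond to the duality relation vanishes separately. -/
theorem localRate_mul_sub_eq {r l : ℝ} (hr : 0 < r) (hl : 0 < l) (k : Bond L) (z η : Config L) :
    localRate r l k η * (D L r l z (exchange k η) - D L r l z η) =
      localRate r l k z * (D L r l (exchange k z) η - D L r l z η) := by
  have hq := (q_pos hr hl).ne'
  have hrq : r = q r l ^ 2 * l := by
    rw [q, Real.sq_sqrt (div_pos hr hl).le, div_mul_cancel₀ _ hl.ne']
  have hrest1 : ∏ x ∈ ({k.left, k.right} : Finset (Site L))ᶜ, siteMatch (z x) (exchange k η x)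
      = ∏ x ∈ ({k.left, k.right} : Finset (Site L))ᶜ, siteMatch (z x) (η x) :=
    Finset.prod_congr rfl fun x hx => by rw [exchange_of_mem_compl k η hx]
  have hrest2 : ∏ x ∈ ({k.left, k.right} : Finset (Site L))ᶜ, siteMatch (exchange k z x) (η x)
      = ∏ x ∈ ({k.left, k.right} : Finset (Site L))ᶜ, siteMatch (z x) (η x) :=
    Finset.prod_congr rfl fun x hx => by rw [exchange_of_mem_compl k z hx]
  simp only [D_eq hr hl, prod_siteMatch k, hrest1, hrest2, exchange_left, exchange_right,
    productExponent_exchange_right, productExponent_exchange_left, measureExponent_exchange]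
  generalize ∏ x ∈ ({k.left, k.right} : Finset (Site L))ᶜ, siteMatch (z x) (η x) = R
  generalize productExponent z η = e
  generalize measureExponent z = m
  -- Isolate the common factor `q ^ (e - m)`, so that only the contents of the bond remain.
  rw [show ∀ u : ℤ, e + u - m = (e - m) + u from fun u => by ring,
    show ∀ u w : ℤ, e - u - (m - 2 * w) = (e - m) + (2 * w - u) from fun u w => by ring]
  simp only [zpow_add₀ hq, localRate, a, b, v]
  generalize q r l ^ (e - m) = Z
  generalize q r l = c at hq hrq
  subst hrq
  generalize z k.left = z₁
  generalize z k.right = z₂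
  generalize η k.left = η₁
  generalize η k.right = η₂
  fin_cases z₁ <;> fin_cases z₂ <;> fin_cases η₁ <;> fin_cases η₂ <;>
    simp [siteMatch] <;> field_simp

/-! ### Conservation of the particle numbers -/

theorem numA_exchange (k : Bond L) (η : Config L) : numA (exchange k η) = numA η := by
  unfold numA posA exchange
  exact Finset.card_equiv (Equiv.swap k.left k.right) (by simp)

theorem numB_exchange (k : Bond L) (η : Config L) : numB (exchange k η) = numB η := by
  unfold numB posB exchange
  exact Finset.card_equiv (Equiv.swap k.left k.right) (by simp)

end TwoASEP

theorem theorem2 (L : ℕ) (r l : ℝ) (hr : 0 < r) (hl : 0 < l) :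
    TwoASEP.IsDual (TwoASEP.H L r l) (TwoASEP.H L r l) (TwoASEP.D L r l) ∧
    Matrix.of (TwoASEP.D L r l) * TwoASEP.H L r l =
      (TwoASEP.H L r l).transpose * Matrix.of (TwoASEP.D L r l) ∧
    ∀ N' M' N M : ℕ, TwoASEP.IsDual (TwoASEP.H L r l) (TwoASEP.H L r l)
      (TwoASEP.Dsector L r l N' M' N M) := by
  have hD := TwoASEP.mul_H_eq_transpose_H_mul r l _ (TwoASEP.localRate_mul_sub_eq (L := L) hr hl)
  refine ⟨TwoASEP.isDual_of_mul_eq_transpose_mul _ _ hD, hD, fun N' M' N M => ?_⟩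
  refine TwoASEP.isDual_of_mul_eq_transpose_mul _ _
    (TwoASEP.mul_H_eq_transpose_H_mul r l _ fun k z η => ?_)
  simp only [TwoASEP.Dsector, TwoASEP.numA_exchange, TwoASEP.numB_exchange]
  split_ifs
  · exact TwoASEP.localRate_mul_sub_eq hr hl k z η
  · simp
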